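/- Let $e\ge 1$ be an integer, $\epsilon=\exp(2\pi i/e)$, and let the cyclic group $C_e=\langle\rho\rangle$ act on $B=\mathbb C[x_1,x_2]$ by $\rho(x_1)=\epsilon x_1$, $\rho(x_2)=\epsilon^{-1}x_2$. Let $\mathcal D_B$ be the algebra of differential operators on $B$ (the Weyl algebra generated by $x_1,x_2,\partial_1,\partial_2$), on which $C_e$ acts by $P\mapsto gPg^{-1}$, and let $\mathcal D_1=\mathcal D_B^{C_e}$. Put $\nabla_i=x_i\partial_i$, $\nabla=\nabla_1+\nabla_2$, $\mathcal D_1(n)=\{P\in\mathcal D_1 : [\nabla,P]=nP\}$ for $n\in\mathbb Z$, $\mathcal D_1^0=\mathcal D_1(0)$, $\mathcal D_1^-=\bigoplus_{n<0}\mathcal D_1(n)$, and $$\mathcal R_1=\mathcal D_1^0/\bigl(\mathcal D_1^0\cap(\mathcal D_1\cdot\mathcal D_1^-)\bigr).$$ Here $\mathcal D_1\cdot\mathcal D_1^-$ is the left ideal of $\mathcal D_1$ generated by $\mathcal D_1^-$. Let $\Pi:\mathbb C[\nabla_1,\nabla_2]\to\mathcal D_1^0\to\mathcal R_1$ be the canonical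 composed homomorphism. (1) If $e$ is odd, then $\mathcal D_1^0$ is generated as a $\mathbb C$-algebra by $\nabla_1,\nabla_2,(x_1\partial_2)^e,(x_2\partial_1)^e$; the map $\Pi$ is surjective, and $\mathcal R_1$ is commutative. (2) If $e=2e_1$ is even, then $\mathcal D_1^0$ is generated as a $\mathbb C$-algebra by $\nabla_1$, $\nabla_2$, $t_1=(x_1\partial_2)^{e_1}$, $t_2=(x_2\partial_1)^{e_1}$. Let $\mathcal E=\operatorname{Im}\Pi$. Then $\mathcal R_1$ is generated by (the classes of) $1,t_1,t_2$ as a left $\mathcal E$-module, and also as a right $\mathcal E$-module. Moreover, $\mathcal R_1$ is not commutative. -/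

import Mathlib

noncomputable section

namespace CyclicWeyl

/-! ### Triangular decomposition of an algebra with a grading element -/

section Graded

variable {D : Type*} [Ring D] [Algebra ℂ D]

/-- The homogeneous part `D(n) = {P | [E, P] = n P}` for the adjoint action of `E`. -/
def degPart (E : D) (n : ℤ) : Submodule ℂ D where
  carrier := {P | E * P - P * E = (n : ℂ) • P}
  zero_mem' := by simp
  add_mem' := by
    intro a b ha hb
    simp only [Set.mem_ofPred_eq] at ha hb ⊢
    rw [smul_add, ← ha, ← hb]
    noncomm_ring
  smul_mem' := by
    intro c a ha
    simp only [Set.mem_ofPred_eq] at ha ⊢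
    rw [mul_smul_comm, smul_mul_assoc, ← smul_sub, ha, smul_comm]

theorem mem_degPart {E : D} {n : ℤ} {P : D} :
    P ∈ degPart E n ↔ E * P - P * E = (n : ℂ) • P := Iff.rfl

theorem mul_mem_degPart {E : D} {m n : ℤ} {P Q : D}
    (hP : P ∈ degPart E m) (hQ : Q ∈ degPart E n) : P * Q ∈ degPart E (m + n) := by
  rw [mem_degPart] at *
  have h : E * (P * Q) - P * Q * E = (E * P - P * E) * Q + P * (E * Q - Q * E) := by
    noncomm_ring
  rw [h, hP, hQ, smul_mul_assoc, mul_smul_comm, ← add_smul]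
  push_cast
  rfl

/-- The degree zero subalgebra `D⁰ = D(0)`. -/
def degZero (E : D) : Subalgebra ℂ D where
  carrier := degPart E 0
  mul_mem' := by
    intro a b ha hb
    simpa using mul_mem_degPart ha hb
  add_mem' := fun ha hb => Submodule.add_mem _ ha hb
  algebraMap_mem' := by
    intro r
    simp only [SetLike.mem_coe, mem_degPart]
    rw [Algebra.commutes]
    simp

theorem mem_degZero {E P : D} : P ∈ degZero E ↔ P ∈ degPart E 0 := Iff.rfl

/-- The negative part `D⁻ = ⊕_{n < 0} D(n)`. -/
def negPart (E : D) : Submodule ℂ D := ⨆ n : ℤ, ⨆ _ : n < 0, degPart E n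

theorem negPart_mul_degZero {E P Q : D} (hP : P ∈ negPart E) (hQ : Q ∈ degZero E) :
    P * Q ∈ negPart E := by
  have h : negPart E ≤ (negPart E).comap (LinearMap.mulRight ℂ Q) := by
    refine iSup₂_le fun n hn x hx => ?_
    have hx' : x * Q ∈ degPart E n := by simpa using mul_mem_degPart hx (mem_degZero.1 hQ)
    exact (le_iSup₂ (f := fun (n : ℤ) (_ : n < 0) => degPart E n) n hn) hx'
  exact h hP

/-- The ideal `D⁰ ∩ (D · D⁻)` of `D⁰`; here `Ideal.span` is the left ideal of `D` generated by
`D⁻`, that is `D · D⁻`. -/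
def lowestIdeal (E : D) : Ideal (degZero E) :=
  (Ideal.span (negPart E : Set D)).comap (degZero E).val

instance (E : D) : (lowestIdeal E).IsTwoSided where
  mul_mem_of_left := by
    intro a b ha
    have key : ∀ x ∈ Ideal.span (negPart E : Set D),
        x * (b : D) ∈ Ideal.span (negPart E : Set D) := by
      intro x hx
      induction hx using Submodule.span_induction with
      | mem x hx => exact Ideal.subset_span (negPart_mul_degZero hx b.2)
      | zero => simp
      | add x y _ _ hx hy => rw [add_mul]; exact Ideal.add_mem _ hx hy
      | smul r x _ hx => rw [smul_eq_mul, mul_assoc]; exact Ideal.mul_mem_left _ _ hx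
    exact key _ ha

/-- The ring `R = D⁰ / (D⁰ ∩ D · D⁻)`. -/
abbrev LowestRing (E : D) : Type _ := degZero E ⧸ lowestIdeal E

/-- The residue class map `D⁰ → R`. -/
def toLowestRing (E : D) : degZero E →ₐ[ℂ] LowestRing E := Ideal.Quotient.mkₐ ℂ (lowestIdeal E)

end Graded

/-! ### The Weyl algebra in two variables and the action of the cyclic group -/

/-- The polynomial ring `B = ℂ[x₁, x₂]`; the variables are `X 0` and `X 1`. -/
abbrev B : Type := MvPolynomial (Fin 2) ℂ

/-- Multiplication by the variable `x_i`, as an operator on `B`. -/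
def xOp (i : Fin 2) : Module.End ℂ B := LinearMap.mulLeft ℂ (MvPolynomial.X i)

/-- The partial derivative `∂_i`, as an operator on `B`. -/
def dOp (i : Fin 2) : Module.End ℂ B := (MvPolynomial.pderiv i).toLinearMap

/-- The algebra of differential operators on `B`, i.e. the Weyl algebra in two variables. -/
def weyl : Subalgebra ℂ (Module.End ℂ B) := Algebra.adjoin ℂ (Set.range xOp ∪ Set.range dOp)

/-- The root of unity `ε = exp(2πi/e)`. -/
def eps (e : ℕ) : ℂ := Complex.exp (2 * Real.pi * Complex.I / e)

theorem eps_ne_zero (e : ℕ) : eps e ≠ 0 := Complex.exp_ne_zero _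

theorem eps_pow (e : ℕ) : eps e ^ e = 1 := by
  rcases Nat.eq_zero_or_pos e with rfl | h
  · simp
  · exact (Complex.isPrimitiveRoot_exp e h.ne').pow_eq_one

/-- The algebra endomorphism of `B` with `x₁ ↦ a x₁`, `x₂ ↦ b x₂`. -/
def diagHom (a b : ℂ) : B →ₐ[ℂ] B :=
  MvPolynomial.aeval ![a • MvPolynomial.X 0, b • MvPolynomial.X 1]

theorem diagHom_comp {a b c d : ℂ} (h : a * c = 1) (h' : b * d = 1) :
    (diagHom a b).comp (diagHom c d) = AlgHom.id ℂ B := by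
  apply MvPolynomial.algHom_ext
  intro i
  fin_cases i <;> simp [diagHom, smul_smul, mul_comm c, mul_comm d, h, h']

/-- The generator `ρ` of the cyclic group: `ρ(x₁) = ε x₁`, `ρ(x₂) = ε⁻¹ x₂`. -/
def rho (e : ℕ) : B ≃ₐ[ℂ] B :=
  AlgEquiv.ofAlgHom (diagHom (eps e) (eps e)⁻¹) (diagHom (eps e)⁻¹ (eps e))
    (diagHom_comp (mul_inv_cancel₀ (eps_ne_zero e)) (inv_mul_cancel₀ (eps_ne_zero e)))
    (diagHom_comp (inv_mul_cancel₀ (eps_ne_zero e)) (mul_inv_cancel₀ (eps_ne_zero e)))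

/-- The cyclic group `C_e`, generated by `ρ`. -/
def cyc (e : ℕ) : Subgroup (B ≃ₐ[ℂ] B) := Subgroup.zpowers (rho e)

/-- The action of an automorphism `g` of `B` on operators, `P ↦ g P g⁻¹`. -/
def act (g : B ≃ₐ[ℂ] B) : Module.End ℂ B ≃ₐ[ℂ] Module.End ℂ B :=
  g.toLinearEquiv.conjAlgEquiv ℂ

theorem act_apply (g : B ≃ₐ[ℂ] B) (P : Module.End ℂ B) (f : B) :
    act g P f = g (P (g.symm f)) := rfl

/-- The algebra `D₁` of `C_e`-invariant differential operators on `B`. -/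
def invOps (e : ℕ) : Subalgebra ℂ (Module.End ℂ B) where
  carrier := {P | P ∈ weyl ∧ ∀ g ∈ cyc e, act g P = P}
  mul_mem' := fun ha hb => ⟨mul_mem ha.1 hb.1, fun g hg => by
    rw [map_mul, ha.2 g hg, hb.2 g hg]⟩
  add_mem' := fun ha hb => ⟨add_mem ha.1 hb.1, fun g hg => by
    rw [map_add, ha.2 g hg, hb.2 g hg]⟩
  algebraMap_mem' := fun r => ⟨Subalgebra.algebraMap_mem _ r, fun g _ => AlgEquiv.commutes _ r⟩

/-- `D₁` as a type, with its ring and algebra structure. -/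
def D1 (e : ℕ) : Type := invOps e

instance (e : ℕ) : Ring (D1 e) := inferInstanceAs (Ring (invOps e))

instance (e : ℕ) : Algebra ℂ (D1 e) := inferInstanceAs (Algebra ℂ (invOps e))

/-- An invariant differential operator as an element of `D₁`. -/
def D1.mk {e : ℕ} (P : Module.End ℂ B) (h : P ∈ invOps e) : D1 e := Subtype.mk P h

theorem act_of_rho {e : ℕ} {P : Module.End ℂ B} (h : act (rho e) P = P) :
    ∀ g ∈ cyc e, act g P = P := by
  have hmul : ∀ a b : B ≃ₐ[ℂ] B, act (a * b) P = act a (act b P) := fun a b => rfl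
  let S : Subgroup (B ≃ₐ[ℂ] B) :=
    { carrier := {g | act g P = P}
      mul_mem' := fun {a b} ha hb => by
        simp only [Set.mem_ofPred_eq] at ha hb ⊢
        rw [hmul, hb, ha]
      one_mem' := rfl
      inv_mem' := fun {a} ha => by
        simp only [Set.mem_ofPred_eq] at ha ⊢
        conv_lhs => rw [← ha]
        rw [← hmul, inv_mul_cancel]
        rfl }
  have hS : cyc e ≤ S := (Subgroup.zpowers_le (H := S)).2 h
  exact fun g hg => hS hg

theorem xOp_apply (i : Fin 2) (f : B) : xOp i f = MvPolynomial.X i * f := rfl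

theorem dOp_apply (i : Fin 2) (f : B) : dOp i f = MvPolynomial.pderiv i f := rfl

/-- The weight of `x_i` under `ρ`. -/
def wt (e : ℕ) : Fin 2 → ℂ := ![eps e, (eps e)⁻¹]

theorem wt_ne_zero (e : ℕ) (i : Fin 2) : wt e i ≠ 0 := by
  fin_cases i <;> simp [wt, eps_ne_zero]

theorem rho_X (e : ℕ) (i : Fin 2) :
    rho e (MvPolynomial.X i) = wt e i • (MvPolynomial.X i : B) := by
  fin_cases i <;> simp [rho, diagHom, wt]

theorem act_xOp (e : ℕ) (i : Fin 2) : act (rho e) (xOp i) = wt e i • xOp i := by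
  refine LinearMap.ext fun f => ?_
  rw [act_apply, xOp_apply, map_mul, AlgEquiv.apply_symm_apply, rho_X, LinearMap.smul_apply,
    xOp_apply, smul_mul_assoc]

theorem rho_pderiv (e : ℕ) (i : Fin 2) (f : B) :
    MvPolynomial.pderiv i (rho e f) = wt e i • rho e (MvPolynomial.pderiv i f) := by
  induction f using MvPolynomial.induction_on with
  | C a =>
    have h : rho e (MvPolynomial.C a) = MvPolynomial.C a := (rho e).commutes a
    rw [h]; simp
  | add p q hp hq => simp only [map_add, hp, hq, smul_add]
  | mul_X p j hp =>
    rw [map_mul, Derivation.leibniz, Derivation.leibniz, hp, rho_X, Derivation.map_smul]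
    simp only [smul_eq_mul, map_add, map_mul, rho_X]
    by_cases hij : j = i
    · subst hij
      simp only [MvPolynomial.pderiv_X_self, map_one, mul_one, smul_add, mul_smul_comm,
        smul_mul_assoc]
    · simp [MvPolynomial.pderiv_X_of_ne hij]

theorem act_dOp (e : ℕ) (i : Fin 2) : act (rho e) (dOp i) = (wt e i)⁻¹ • dOp i := by
  refine LinearMap.ext fun f => ?_
  have h := rho_pderiv e i ((rho e).symm f)
  rw [AlgEquiv.apply_symm_apply] at h
  rw [act_apply, dOp_apply, LinearMap.smul_apply, dOp_apply, h, smul_smul,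
    inv_mul_cancel₀ (wt_ne_zero e i), one_smul]

theorem xOp_mem (i : Fin 2) : xOp i ∈ weyl := Algebra.subset_adjoin (Or.inl ⟨i, rfl⟩)

theorem dOp_mem (i : Fin 2) : dOp i ∈ weyl := Algebra.subset_adjoin (Or.inr ⟨i, rfl⟩)

/-- `(x_i ∂_j)^k` is `C_e`-invariant if `i = j` or if `e` divides `2k`. -/
theorem xd_pow_mem {e k : ℕ} {i j : Fin 2} (h : i = j ∨ e ∣ 2 * k) :
    (xOp i * dOp j) ^ k ∈ invOps e := by
  refine ⟨pow_mem (mul_mem (xOp_mem i) (dOp_mem j)) k, act_of_rho ?_⟩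
  rw [map_pow, map_mul, act_xOp, act_dOp, smul_mul_smul_comm, smul_pow]
  suffices hs : (wt e i * (wt e j)⁻¹) ^ k = 1 by rw [hs, one_smul]
  rcases h with rfl | ⟨m, hm⟩
  · rw [mul_inv_cancel₀ (wt_ne_zero e i), one_pow]
  · have h1 : (eps e * eps e) ^ k = 1 := by
      rw [← pow_two, ← pow_mul, hm, pow_mul, eps_pow, one_pow]
    have h2 : ((eps e)⁻¹ * (eps e)⁻¹) ^ k = 1 := by
      rw [← mul_inv, inv_pow, h1, inv_one]
    fin_cases i <;> fin_cases j <;> simp [wt, eps_ne_zero, h1] ; simpa using h2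

/-- The operator `∇_i = x_i ∂_i` as an element of `D₁`. -/
def nablaInv (e : ℕ) (i : Fin 2) : D1 e :=
  D1.mk (xOp i * dOp i) (by simpa using xd_pow_mem (e := e) (k := 1) (Or.inl (rfl : i = i)))

/-- The Euler operator `∇ = ∇₁ + ∇₂`, which defines the grading of `D₁`. -/
def euler (e : ℕ) : D1 e := nablaInv e 0 + nablaInv e 1

/-- The degree zero algebra `D₁⁰`. -/
abbrev D0 (e : ℕ) : Subalgebra ℂ (D1 e) := degZero (euler e)

/-- The ring `R₁ = D₁⁰ / (D₁⁰ ∩ D₁ · D₁⁻)`. -/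
abbrev R1 (e : ℕ) : Type := LowestRing (euler e)

theorem euler_comm_xd (i j : Fin 2) :
    Commute (xOp 0 * dOp 0 + xOp 1 * dOp 1) (xOp i * dOp j) := by
  have hc : ∀ a b : Fin 2, ∀ f : B, MvPolynomial.pderiv a (MvPolynomial.pderiv b f)
      = MvPolynomial.pderiv b (MvPolynomial.pderiv a f) := by
    intro a b f
    have h : ⁅(MvPolynomial.pderiv a : Derivation ℂ B B), (MvPolynomial.pderiv b : Derivation ℂ B B)⁆ = 0 := by
      apply MvPolynomial.derivation_ext
      intro c
      rw [Derivation.commutator_apply]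
      simp only [MvPolynomial.pderiv_X, Pi.single_apply]
      split_ifs <;> simp
    have h2 := congrArg (fun d : Derivation ℂ B B => d f) h
    simp only [Derivation.commutator_apply] at h2
    exact sub_eq_zero.1 h2
  refine LinearMap.ext fun f => ?_
  simp only [Module.End.mul_apply, LinearMap.add_apply, xOp_apply, dOp_apply, map_add,
    Derivation.leibniz, smul_eq_mul]
  have h01 := hc 1 0 f
  fin_cases i <;> fin_cases j <;>
    simp only [Fin.zero_eta, Fin.mk_one, Fin.isValue, MvPolynomial.pderiv_X_self,
      MvPolynomial.pderiv_X_of_ne (R := ℂ) (zero_ne_one : (0 : Fin 2) ≠ 1),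
      MvPolynomial.pderiv_X_of_ne (R := ℂ) (one_ne_zero : (1 : Fin 2) ≠ 0), h01] <;> ring

theorem xd_pow_mem_degZero {e k : ℕ} {i j : Fin 2} (h : i = j ∨ e ∣ 2 * k) :
    D1.mk ((xOp i * dOp j) ^ k) (xd_pow_mem h) ∈ D0 e := by
  have hcom : (xOp 0 * dOp 0 + xOp 1 * dOp 1) * (xOp i * dOp j) ^ k
      = (xOp i * dOp j) ^ k * (xOp 0 * dOp 0 + xOp 1 * dOp 1) :=
    (euler_comm_xd i j).pow_right k
  rw [mem_degZero, mem_degPart, Int.cast_zero, zero_smul, sub_eq_zero]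
  exact Subtype.ext hcom

/-- The operator `(x_i ∂_j)^k` as an element of `D₁⁰`. -/
def xdPow (e k : ℕ) (i j : Fin 2) (h : i = j ∨ e ∣ 2 * k) : D0 e :=
  ⟨D1.mk ((xOp i * dOp j) ^ k) (xd_pow_mem h), xd_pow_mem_degZero h⟩

/-- The operator `∇_i = x_i ∂_i` as an element of `D₁⁰`. -/
def nabla (e : ℕ) (i : Fin 2) : D0 e := xdPow e 1 i i (Or.inl rfl)

/-- `(x₁ ∂₂)^k` as an element of `D₁⁰`, where `e ∣ 2k`. -/
def raise (e k : ℕ) (h : e ∣ 2 * k) : D0 e := xdPow e k 0 1 (Or.inr h)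

/-- `(x₂ ∂₁)^k` as an element of `D₁⁰`, where `e ∣ 2k`. -/
def lower (e k : ℕ) (h : e ∣ 2 * k) : D0 e := xdPow e k 1 0 (Or.inr h)

/-- The residue class map `D₁⁰ → R₁`. -/
def proj (e : ℕ) : D0 e →ₐ[ℂ] R1 e := toLowestRing (euler e)

/-- The subalgebra `ℂ[∇₁, ∇₂]` of `D₁⁰`. -/
def nablaAlg (e : ℕ) : Subalgebra ℂ (D0 e) := Algebra.adjoin ℂ {nabla e 0, nabla e 1}

/-- The composed homomorphism `Π : ℂ[∇₁, ∇₂] → D₁⁰ → R₁`. -/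
def bigPi (e : ℕ) : nablaAlg e →ₐ[ℂ] R1 e := (proj e).comp (nablaAlg e).val

end CyclicWeyl

end

noncomputable section

namespace CyclicWeyl

/-! ### Eigenvectors, and modules over a normalized subalgebra -/

section Generic

variable {D : Type*} [Ring D] [Algebra ℂ D]

/-! The Weyl algebra is spanned by the monomials x₁ᵃx₂ᵇ∂₁ᶜ∂₂ᵈ. Each is an eigenvector of ad ∇, with
eigenvalue a+b-c-d, and of ρ, with eigenvalue ε^(a-b-c+d). Hence D₁⁰ is spanned by the monomials
with a+b = c+d and e ∣ 2(a-c). With m = |a-c|, such a monomial is xᵢᵐ∂ⱼᵐ times falling factorials in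
∇₁ and ∇₂. The m with e ∣ 2m are the multiples of k, where k = e for odd e and k = e/2 for even e,
so xᵢᵐ∂ⱼᵐ is a power of (xᵢ∂ⱼ)ᵏ (`mem_of_invariant`).

In R₁ the class of xᵢᵉ∂ⱼᵉ vanishes, because ∂ⱼᵉ is itself invariant of negative degree
(`proj_eq_zero_of_pow`). For odd e this kills two of the four generators and leaves ∇₁, ∇₂, which
commute. For even e it gives t₁² = t₂² = 0. Since t₁t₂ and t₂t₁ are polynomials in the ∇ᵢ, and tᵢ
commutes with each ∇ⱼ up to a scalar shift, ℰ + ℰt₁ + ℰt₂ is closed under multiplication.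

As [∇₁, t₁] = e₁t₁, noncommutativity amounts to t₁ ≠ 0 in R₁. Evaluation at x₂^e₁ detects this: D₁⁻
annihilates that polynomial by degree and weight, while t₁ sends it to e₁!·x₁^e₁. -/

theorem one_mem_degPart (E : D) : (1 : D) ∈ degPart E 0 := by simp [mem_degPart]

theorem pow_mem_degPart {E P : D} {n : ℤ} (h : P ∈ degPart E n) (k : ℕ) :
    P ^ k ∈ degPart E (k * n) := by
  induction k with
  | zero => simpa using one_mem_degPart E
  | succ k ih =>
    rw [pow_succ]
    have := mul_mem_degPart ih h
    rwa [show ((k + 1 : ℕ) : ℤ) * n = k * n + n by push_cast; ring]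

theorem degPart_of_commute {E P : D} (h : Commute E P) : P ∈ degPart E 0 := by
  rw [mem_degPart, h.eq]; simp

theorem commute_of_mem_degPart {E P : D} (h : P ∈ degPart E 0) : Commute E P := by
  rw [mem_degPart] at h
  rw [Int.cast_zero, zero_smul, sub_eq_zero] at h
  exact h

theorem degPart_add {E F P : D} {m n : ℤ} (hE : P ∈ degPart E m) (hF : P ∈ degPart F n) :
    P ∈ degPart (E + F) (m + n) := by
  rw [mem_degPart] at *
  rw [add_mul, mul_add, add_sub_add_comm, hE, hF, ← add_smul]
  push_cast; rfl

/-- If `v` is a combination of eigenvectors of `T` and itself an eigenvector for `μ`, then only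
the eigenvectors for `μ` are needed. -/
theorem mem_span_eigen {V : Type*} [AddCommGroup V] [Module ℂ V] (T : Module.End ℂ V) (S : Set V)
    (f : V → ℂ) (hS : ∀ s ∈ S, T s = f s • s) {v : V} {μ : ℂ} (hv : v ∈ Submodule.span ℂ S)
    (hT : T v = μ • v) : v ∈ Submodule.span ℂ {s ∈ S | f s = μ} := by
  have hu : S = {s ∈ S | f s = μ} ∪ {s ∈ S | f s ≠ μ} := by
    ext s; by_cases h : f s = μ <;> simp [h]
  rw [hu, Submodule.span_union, Submodule.mem_sup] at hv
  obtain ⟨a, ha, b, hb, rfl⟩ := hv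
  have ha' : a ∈ T.eigenspace μ := by
    refine (Submodule.span_le (p := T.eigenspace μ)).2 ?_ ha
    rintro s ⟨hs, h⟩
    rw [SetLike.mem_coe, Module.End.mem_eigenspace_iff, hS s hs, h]
  have hb' : b ∈ T.eigenspace μ := by
    have : a + b ∈ T.eigenspace μ := Module.End.mem_eigenspace_iff.2 hT
    simpa using Submodule.sub_mem _ this ha'
  -- The remainder b lies both in the μ-eigenspace and in the sum of the others, so independence of
  -- eigenspaces makes it zero.
  have hb'' : b ∈ ⨆ ν, ⨆ _ : ν ≠ μ, T.eigenspace ν := by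
    refine Submodule.span_le.2 ?_ hb
    rintro s ⟨hs, h⟩
    exact (le_iSup₂ (f := fun (ν : ℂ) (_ : ν ≠ μ) => T.eigenspace ν) (f s) h)
      (Module.End.mem_eigenspace_iff.2 (hS s hs))
  have := (Module.End.eigenspaces_iSupIndep T μ).le_bot ⟨hb', hb''⟩
  rw [Submodule.mem_bot] at this
  simpa [this] using ha

/-- Left module generation by `1, s, t`, for a subalgebra normalized by `s` and `t`. -/
theorem exists_left_combination {n₁ n₂ s t : D} (htop : Algebra.adjoin ℂ {n₁, n₂, s, t} = ⊤)
    {U : Subalgebra ℂ D} (h₁ : n₁ ∈ U) (h₂ : n₂ ∈ U)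
    (hs₁ : ∃ u ∈ U, s * n₁ = u * s) (hs₂ : ∃ u ∈ U, s * n₂ = u * s)
    (ht₁ : ∃ u ∈ U, t * n₁ = u * t) (ht₂ : ∃ u ∈ U, t * n₂ = u * t)
    (hss : s * s = 0) (htt : t * t = 0) (hst : s * t ∈ U) (hts : t * s ∈ U) (r : D) :
    ∃ a b c : U, r = (a : D) + b * s + c * t := by
  -- U + Us + Ut is stable under right multiplication by the whole algebra; applying this to 1 gives
  -- the claim.
  suffices H : ∀ p ∈ Algebra.adjoin ℂ ({n₁, n₂, s, t} : Set D), ∀ a ∈ U, ∀ b ∈ U, ∀ c ∈ U,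
      ∃ a' b' c' : U, (a + b * s + c * t) * p = (a' : D) + b' * s + c' * t by
    simpa using H r (htop ▸ Algebra.mem_top) 1 (one_mem U) 0 (zero_mem U) 0 (zero_mem U)
  intro p hp
  induction hp using Algebra.adjoin_induction with
  | mem x hx =>
    intro a ha b hb c hc
    rcases hx with rfl | rfl | rfl | rfl
    · obtain ⟨u, hu, hu'⟩ := hs₁
      obtain ⟨v, hv, hv'⟩ := ht₁
      refine ⟨⟨_, mul_mem ha h₁⟩, ⟨_, mul_mem hb hu⟩, ⟨_, mul_mem hc hv⟩, ?_⟩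
      simp only [add_mul, mul_assoc, hu', hv']
    · obtain ⟨u, hu, hu'⟩ := hs₂
      obtain ⟨v, hv, hv'⟩ := ht₂
      refine ⟨⟨_, mul_mem ha h₂⟩, ⟨_, mul_mem hb hu⟩, ⟨_, mul_mem hc hv⟩, ?_⟩
      simp only [add_mul, mul_assoc, hu', hv']
    -- (a + bs + ct)s = c(ts) + as, because s² = 0.
    · refine ⟨⟨_, mul_mem hc hts⟩, ⟨_, ha⟩, 0, ?_⟩
      simp [add_mul, mul_assoc, hss, add_comm]
    · refine ⟨⟨_, mul_mem hb hst⟩, 0, ⟨_, ha⟩, ?_⟩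
      simp [add_mul, mul_assoc, htt, add_comm]
  | algebraMap z =>
    intro a ha b hb c hc
    refine ⟨⟨_, Subalgebra.smul_mem U ha z⟩, ⟨_, Subalgebra.smul_mem U hb z⟩,
      ⟨_, Subalgebra.smul_mem U hc z⟩, ?_⟩
    simp [Algebra.algebraMap_eq_smul_one]
  | add x y _ _ hx hy =>
    intro a ha b hb c hc
    obtain ⟨a₁, b₁, c₁, e₁⟩ := hx a ha b hb c hc
    obtain ⟨a₂, b₂, c₂, e₂⟩ := hy a ha b hb c hc
    refine ⟨a₁ + a₂, b₁ + b₂, c₁ + c₂, ?_⟩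
    rw [mul_add, e₁, e₂]
    push_cast
    noncomm_ring
  | mul x y _ _ hx hy =>
    intro a ha b hb c hc
    obtain ⟨a₁, b₁, c₁, e₁⟩ := hx a ha b hb c hc
    rw [← mul_assoc, e₁]
    exact hy _ a₁.2 _ b₁.2 _ c₁.2

/-- Right module generation by `1, s, t`, for a subalgebra normalized by `s` and `t`. -/
theorem exists_right_combination {n₁ n₂ s t : D} (htop : Algebra.adjoin ℂ {n₁, n₂, s, t} = ⊤)
    {U : Subalgebra ℂ D} (h₁ : n₁ ∈ U) (h₂ : n₂ ∈ U)
    (hs₁ : ∃ u ∈ U, n₁ * s = s * u) (hs₂ : ∃ u ∈ U, n₂ * s = s * u)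
    (ht₁ : ∃ u ∈ U, n₁ * t = t * u) (ht₂ : ∃ u ∈ U, n₂ * t = t * u)
    (hss : s * s = 0) (htt : t * t = 0) (hst : s * t ∈ U) (hts : t * s ∈ U) (r : D) :
    ∃ a b c : U, r = (a : D) + s * b + t * c := by
  -- Mirror image: U + sU + tU is stable under left multiplication.
  suffices H : ∀ p ∈ Algebra.adjoin ℂ ({n₁, n₂, s, t} : Set D), ∀ a ∈ U, ∀ b ∈ U, ∀ c ∈ U,
      ∃ a' b' c' : U, p * (a + s * b + t * c) = (a' : D) + s * b' + t * c' by
    simpa using H r (htop ▸ Algebra.mem_top) 1 (one_mem U) 0 (zero_mem U) 0 (zero_mem U)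
  intro p hp
  induction hp using Algebra.adjoin_induction with
  | mem x hx =>
    intro a ha b hb c hc
    rcases hx with rfl | rfl | rfl | rfl
    · obtain ⟨u, hu, hu'⟩ := hs₁
      obtain ⟨v, hv, hv'⟩ := ht₁
      refine ⟨⟨_, mul_mem h₁ ha⟩, ⟨_, mul_mem hu hb⟩, ⟨_, mul_mem hv hc⟩, ?_⟩
      simp only [mul_add, ← mul_assoc, hu', hv']
    · obtain ⟨u, hu, hu'⟩ := hs₂
      obtain ⟨v, hv, hv'⟩ := ht₂
      refine ⟨⟨_, mul_mem h₂ ha⟩, ⟨_, mul_mem hu hb⟩, ⟨_, mul_mem hv hc⟩, ?_⟩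
      simp only [mul_add, ← mul_assoc, hu', hv']
    · refine ⟨⟨_, mul_mem hst hc⟩, ⟨_, ha⟩, 0, ?_⟩
      simp [mul_add, ← mul_assoc, hss, add_comm]
    · refine ⟨⟨_, mul_mem hts hb⟩, 0, ⟨_, ha⟩, ?_⟩
      simp [mul_add, ← mul_assoc, htt, add_comm]
  | algebraMap z =>
    intro a ha b hb c hc
    refine ⟨⟨_, Subalgebra.smul_mem U ha z⟩, ⟨_, Subalgebra.smul_mem U hb z⟩,
      ⟨_, Subalgebra.smul_mem U hc z⟩, ?_⟩
    simp [Algebra.algebraMap_eq_smul_one]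
  | add x y _ _ hx hy =>
    intro a ha b hb c hc
    obtain ⟨a₁, b₁, c₁, e₁⟩ := hx a ha b hb c hc
    obtain ⟨a₂, b₂, c₂, e₂⟩ := hy a ha b hb c hc
    refine ⟨a₁ + a₂, b₁ + b₂, c₁ + c₂, ?_⟩
    rw [add_mul, e₁, e₂]
    push_cast
    noncomm_ring
  | mul x y _ _ hx hy =>
    intro a ha b hb c hc
    obtain ⟨a₁, b₁, c₁, e₁⟩ := hy a ha b hb c hc
    rw [mul_assoc, e₁]
    exact hx _ a₁.2 _ b₁.2 _ c₁.2

end Generic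

/-! ### Commutation relations in the Weyl algebra -/

theorem xOp_commute (i j : Fin 2) : Commute (xOp i) (xOp j) :=
  LinearMap.ext fun f => by simp only [Module.End.mul_apply, xOp_apply]; ring

theorem dOp_commute (i j : Fin 2) : Commute (dOp i) (dOp j) := by
  have h : ⁅(MvPolynomial.pderiv i : Derivation ℂ B B), (MvPolynomial.pderiv j : Derivation ℂ B B)⁆ = 0 := by
    apply MvPolynomial.derivation_ext
    intro c
    rw [Derivation.commutator_apply]
    simp only [MvPolynomial.pderiv_X, Pi.single_apply]
    split_ifs <;> simp
  refine LinearMap.ext fun f => ?_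
  have h2 := congrArg (fun d : Derivation ℂ B B => d f) h
  simp only [Derivation.commutator_apply] at h2
  exact sub_eq_zero.1 h2

theorem xOp_dOp_commute {i j : Fin 2} (h : i ≠ j) : Commute (xOp i) (dOp j) :=
  LinearMap.ext fun f => by
    simp [Module.End.mul_apply, xOp_apply, dOp_apply, MvPolynomial.pderiv_X_of_ne h]

theorem dOp_mul_xOp (i : Fin 2) : dOp i * xOp i = xOp i * dOp i + 1 :=
  LinearMap.ext fun f => by
    simp [Module.End.mul_apply, xOp_apply, dOp_apply]

/-- The truncated exponent at n = 0 is harmless, since its coefficient is then zero. -/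
theorem dOp_mul_xOp_pow (i : Fin 2) (n : ℕ) :
    dOp i * xOp i ^ n = xOp i ^ n * dOp i + n • xOp i ^ (n - 1) := by
  induction n with
  | zero => simp
  | succ n ih =>
    rw [pow_succ, ← mul_assoc, ih, add_mul, mul_assoc, dOp_mul_xOp]
    rcases n with _ | n
    · simp
    · simp only [Nat.add_sub_cancel, smul_mul_assoc, ← pow_succ]
      rw [mul_add, mul_one, ← mul_assoc, ← pow_succ, add_assoc, ← succ_nsmul']

theorem xOp_mem_degPart (i : Fin 2) : xOp i ∈ degPart (xOp i * dOp i) 1 := by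
  rw [mem_degPart, mul_assoc, dOp_mul_xOp]
  simp [mul_add]

theorem dOp_mem_degPart (i : Fin 2) : dOp i ∈ degPart (xOp i * dOp i) (-1) := by
  rw [mem_degPart, ← mul_assoc, dOp_mul_xOp]
  simp [add_mul]

theorem xOp_mem_degPart_of_ne {i j : Fin 2} (h : i ≠ j) : xOp j ∈ degPart (xOp i * dOp i) 0 :=
  degPart_of_commute ((xOp_commute i j).mul_left (xOp_dOp_commute h.symm).symm)

theorem dOp_mem_degPart_of_ne {i j : Fin 2} (h : i ≠ j) : dOp j ∈ degPart (xOp i * dOp i) 0 :=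
  degPart_of_commute ((xOp_dOp_commute h).mul_left (dOp_commute i j))

/-- The Euler operator on `B`. -/
def eulerOp : Module.End ℂ B := xOp 0 * dOp 0 + xOp 1 * dOp 1

theorem xOp_mem_degPart_euler (i : Fin 2) : xOp i ∈ degPart eulerOp 1 := by
  unfold eulerOp
  match i with
  | 0 =>
    have := degPart_add (xOp_mem_degPart 0)
      (xOp_mem_degPart_of_ne (i := 1) (j := 0) (by decide))
    rwa [add_zero] at this
  | 1 =>
    have := degPart_add (xOp_mem_degPart_of_ne (i := 0) (j := 1) (by decide))
      (xOp_mem_degPart 1)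
    rwa [zero_add] at this

theorem dOp_mem_degPart_euler (i : Fin 2) : dOp i ∈ degPart eulerOp (-1) := by
  unfold eulerOp
  match i with
  | 0 =>
    have := degPart_add (dOp_mem_degPart 0)
      (dOp_mem_degPart_of_ne (i := 1) (j := 0) (by decide))
    rwa [add_zero] at this
  | 1 =>
    have := degPart_add (dOp_mem_degPart_of_ne (i := 0) (j := 1) (by decide))
      (dOp_mem_degPart 1)
    rwa [zero_add] at this

/-- Because xᵢⁿ has degree n for ad ∇ᵢ. Iteration produces the falling factorials ∇ᵢ(∇ᵢ-1)⋯; the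
factor P allows use inside longer products. -/
theorem xOp_pow_succ_mul_dOp_pow (i : Fin 2) (n : ℕ) (P : Module.End ℂ B) :
    xOp i ^ (n + 1) * (dOp i * P) = (xOp i * dOp i - (n : ℂ) • 1) * (xOp i ^ n * P) := by
  have h := pow_mem_degPart (xOp_mem_degPart i) n
  rw [mem_degPart, sub_eq_iff_eq_add] at h
  rw [sub_mul, ← mul_assoc (xOp i * dOp i), h]
  simp [add_mul, pow_succ, mul_assoc]

theorem mul_dOp_pow_succ (i : Fin 2) (n : ℕ) (P : Module.End ℂ B) :
    P * xOp i * dOp i ^ (n + 1) = P * dOp i ^ n * (xOp i * dOp i - (n : ℂ) • 1) := by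
  have h := pow_mem_degPart (dOp_mem_degPart i) n
  rw [mem_degPart, sub_eq_iff_eq_add] at h
  have h' : dOp i ^ n * (xOp i * dOp i) = xOp i * dOp i * dOp i ^ n + (n : ℂ) • dOp i ^ n := by
    rw [h]; simp
  rw [mul_sub, mul_assoc P (dOp i ^ n) (xOp i * dOp i), h']
  simp [mul_add, pow_succ', mul_assoc]

/-! ### Normally ordered monomials -/

/-- The normally ordered monomial `x₁ᵃ x₂ᵇ ∂₁ᶜ ∂₂ᵈ`. -/
def mon (a b c d : ℕ) : Module.End ℂ B := xOp 0 ^ a * xOp 1 ^ b * dOp 0 ^ c * dOp 1 ^ d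

/-- The set of normally ordered monomials. -/
def monSet : Set (Module.End ℂ B) := {s | ∃ a b c d, s = mon a b c d}

theorem xOp_mul_mon_mem (i : Fin 2) (a b c d : ℕ) : xOp i * mon a b c d ∈ monSet := by
  fin_cases i
  · refine ⟨a + 1, b, c, d, ?_⟩
    simp [mon, pow_succ', mul_assoc]
  · refine ⟨a, b + 1, c, d, ?_⟩
    have h := ((xOp_commute 1 0).pow_right a).eq
    simp only [mon, pow_succ', ← mul_assoc, Fin.mk_one, h]

theorem dOp_mul_mon_mem (i : Fin 2) (a b c d : ℕ) :
    dOp i * mon a b c d ∈ Submodule.span ℂ monSet := by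
  fin_cases i
  · have h := ((xOp_dOp_commute (i := 1) (j := 0) (by decide)).symm.pow_right b).eq
    have : dOp 0 * mon a b c d = mon a b (c + 1) d + a • mon (a - 1) b c d := by
      simp only [mon, ← mul_assoc, dOp_mul_xOp_pow, add_mul, smul_mul_assoc]
      rw [mul_assoc _ (dOp 0) (xOp 1 ^ b), h, pow_succ' (dOp 0)]
      simp only [mul_assoc]
    change dOp 0 * mon a b c d ∈ _
    rw [this]
    exact add_mem (Submodule.subset_span ⟨_, _, _, _, rfl⟩)
      (Submodule.smul_of_tower_mem _ a (Submodule.subset_span ⟨_, _, _, _, rfl⟩))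
  · have h := ((xOp_dOp_commute (i := 0) (j := 1) (by decide)).symm.pow_right a).eq
    have h' := ((dOp_commute 1 0).pow_right c).eq
    have : dOp 1 * mon a b c d = mon a b c (d + 1) + b • mon a (b - 1) c d := by
      simp only [mon, ← mul_assoc, h]
      rw [mul_assoc _ (dOp 1) (xOp 1 ^ b), dOp_mul_xOp_pow]
      simp only [mul_add, add_mul, smul_mul_assoc, mul_smul_comm, ← mul_assoc]
      rw [mul_assoc _ (dOp 1) (dOp 0 ^ c), h', pow_succ' (dOp 1)]
      simp only [mul_assoc]
    change dOp 1 * mon a b c d ∈ _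
    rw [this]
    exact add_mem (Submodule.subset_span ⟨_, _, _, _, rfl⟩)
      (Submodule.smul_of_tower_mem _ b (Submodule.subset_span ⟨_, _, _, _, rfl⟩))

/-- The span contains 1 and is stable under left multiplication by the generators. Linear
independence of the monomials is not needed anywhere. -/
theorem weyl_le_span {P : Module.End ℂ B} (hP : P ∈ weyl) : P ∈ Submodule.span ℂ monSet := by
  suffices H : ∀ w ∈ Submodule.span ℂ monSet, P * w ∈ Submodule.span ℂ monSet by
    simpa using H 1 (Submodule.subset_span ⟨0, 0, 0, 0, by simp [mon]⟩)
  induction hP using Algebra.adjoin_induction with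
  | mem x hx =>
    intro w hw
    suffices H : Submodule.span ℂ monSet
        ≤ (Submodule.span ℂ monSet).comap (LinearMap.mulLeft ℂ x) from H hw
    rw [Submodule.span_le]
    rintro _ ⟨a, b, c, d, rfl⟩
    rcases hx with ⟨i, rfl⟩ | ⟨i, rfl⟩
    · exact Submodule.subset_span (xOp_mul_mon_mem i a b c d)
    · exact dOp_mul_mon_mem i a b c d
  | algebraMap z =>
    intro w hw
    rw [← Algebra.smul_def]
    exact Submodule.smul_mem _ z hw
  | add x y _ _ hx hy => intro w hw; rw [add_mul]; exact add_mem (hx w hw) (hy w hw)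
  | mul x y _ _ hx hy => intro w hw; rw [mul_assoc]; exact hx _ (hy w hw)

theorem mon_mem_degPart (a b c d : ℕ) :
    mon a b c d ∈ degPart eulerOp ((a : ℤ) + b - c - d) := by
  have := mul_mem_degPart (mul_mem_degPart (mul_mem_degPart
    (pow_mem_degPart (xOp_mem_degPart_euler 0) a) (pow_mem_degPart (xOp_mem_degPart_euler 1) b))
    (pow_mem_degPart (dOp_mem_degPart_euler 0) c)) (pow_mem_degPart (dOp_mem_degPart_euler 1) d)
  rwa [show (a : ℤ) + b - c - d = a * 1 + b * 1 + c * -1 + d * -1 by ring]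

theorem act_mon (e a b c d : ℕ) :
    act (rho e) (mon a b c d) =
      (wt e 0 ^ a * wt e 1 ^ b * (wt e 0)⁻¹ ^ c * (wt e 1)⁻¹ ^ d) • mon a b c d := by
  simp only [mon, map_mul, map_pow, act_xOp, act_dOp, smul_pow, smul_mul_smul_comm]

/-- Membership of a monomial of degree zero in a subalgebra containing `∇_i`, `∇_j` and
`x_iᵐ ∂_jᵐ`. -/
theorem monomial_mem_of_pow_mem {U : Subalgebra ℂ (Module.End ℂ B)} {i j : Fin 2} (hij : i ≠ j)
    (hi : xOp i * dOp i ∈ U) (hj : xOp j * dOp j ∈ U) {m : ℕ} (hm : xOp i ^ m * dOp j ^ m ∈ U)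
    (a b : ℕ) : xOp i ^ (m + b) * dOp i ^ b * (xOp j ^ a * dOp j ^ (a + m)) ∈ U := by
  -- Raising a inserts the factor ∇ⱼ - a, raising b the factor ∇ᵢ - b; both lie in U, and the base
  -- case is xᵢᵐ∂ⱼᵐ.
  induction b with
  | zero =>
    simp only [add_zero, pow_zero, mul_one]
    induction a with
    | zero => simpa using hm
    | succ a ih =>
      have h : xOp i ^ m * (xOp j ^ (a + 1) * dOp j ^ (a + 1 + m))
          = (xOp j * dOp j - (a : ℂ) • 1) * (xOp i ^ m * (xOp j ^ a * dOp j ^ (a + m))) := by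
        have hc : Commute (xOp i ^ m) (xOp j * dOp j - (a : ℂ) • 1) :=
          Commute.sub_right (((xOp_commute i j).mul_right (xOp_dOp_commute hij)).pow_left m)
            ((Commute.one_right _).smul_right _)
        rw [show a + 1 + m = (a + m) + 1 by ring, pow_succ' (dOp j), xOp_pow_succ_mul_dOp_pow,
          ← mul_assoc, hc.eq, mul_assoc]
      rw [h]
      exact mul_mem (sub_mem hj (Subalgebra.smul_mem U (one_mem U) _)) ih
  | succ b ih =>
    have hc : Commute (xOp i * dOp i - (b : ℂ) • 1) (xOp j ^ a * dOp j ^ (a + m)) :=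
      Commute.sub_left (((commute_of_mem_degPart (xOp_mem_degPart_of_ne hij)).pow_right a).mul_right
        ((commute_of_mem_degPart (dOp_mem_degPart_of_ne hij)).pow_right _))
        ((Commute.one_left _).smul_left _)
    rw [← add_assoc, pow_succ (xOp i), mul_dOp_pow_succ, mul_assoc, hc.eq, ← mul_assoc]
    exact mul_mem ih (sub_mem hi (Subalgebra.smul_mem U (one_mem U) _))

theorem xd_pow {i j : Fin 2} (hij : i ≠ j) (m : ℕ) :
    (xOp i * dOp j) ^ m = xOp i ^ m * dOp j ^ m := (xOp_dOp_commute hij).mul_pow m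

/-- In degree zero, a surplus m of x₁ over ∂₁ is matched by a surplus m of ∂₂ over x₂; the factors
are regrouped by variable. -/
theorem mon_eq_of_zero_one (m a b : ℕ) :
    mon (m + b) a b (a + m) = xOp 0 ^ (m + b) * dOp 0 ^ b * (xOp 1 ^ a * dOp 1 ^ (a + m)) := by
  have h := ((xOp_dOp_commute (i := 1) (j := 0) (by decide)).pow_pow a b).eq
  simp only [mon, mul_assoc]
  rw [← mul_assoc (xOp 1 ^ a), h, mul_assoc]

theorem mon_eq_of_one_zero (m a b : ℕ) :
    mon a (m + b) (a + m) b = xOp 1 ^ (m + b) * dOp 1 ^ b * (xOp 0 ^ a * dOp 0 ^ (a + m)) := by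
  have h1 := ((xOp_commute 0 1).pow_pow a (m + b)).eq
  have h2 := ((dOp_commute 0 1).pow_pow (a + m) b).eq
  have h3 := ((xOp_dOp_commute (i := 0) (j := 1) (by decide)).pow_pow a b).eq
  simp only [mon]
  rw [h1, mul_assoc, h2, mul_assoc, ← mul_assoc (xOp 0 ^ a), h3]
  simp only [mul_assoc]

theorem eps_isPrimitiveRoot {e : ℕ} (he : 0 < e) : IsPrimitiveRoot (eps e) e :=
  Complex.isPrimitiveRoot_exp e he.ne'

/-- Invariant operators of degree zero lie in any subalgebra that contains the `∇_i` and the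
invariant powers of `x_i ∂_j`. -/
theorem mem_of_invariant {e k : ℕ} (he : 0 < e) (hk : ∀ m, e ∣ 2 * m → k ∣ m)
    {U : Subalgebra ℂ (Module.End ℂ B)} (h0 : xOp 0 * dOp 0 ∈ U) (h1 : xOp 1 * dOp 1 ∈ U)
    (h01 : (xOp 0 * dOp 1) ^ k ∈ U) (h10 : (xOp 1 * dOp 0) ^ k ∈ U)
    {P : Module.End ℂ B} (hP : P ∈ weyl) (hdeg : eulerOp * P - P * eulerOp = 0)
    (hact : act (rho e) P = P) : P ∈ U := by
  have hpow : ∀ {i j : Fin 2}, i ≠ j → (xOp i * dOp j) ^ k ∈ U → ∀ m, e ∣ 2 * m →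
      xOp i ^ m * dOp j ^ m ∈ U := by
    intro i j hij h m hm
    obtain ⟨q, rfl⟩ := hk m hm
    rw [← xd_pow hij, pow_mul]
    exact pow_mem h q
  classical
  let deg : Module.End ℂ B → ℂ := fun s => if eulerOp * s - s * eulerOp = 0 then 0 else 1
  have hdiff : ∀ s ∈ monSet, ∃ z : ℂ, eulerOp * s - s * eulerOp = z • s := by
    rintro _ ⟨a, b, c, d, rfl⟩
    exact ⟨_, mon_mem_degPart a b c d⟩
  have hact' : ∀ s ∈ monSet, ∃ z : ℂ, act (rho e) s = z • s := by
    rintro _ ⟨a, b, c, d, rfl⟩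
    exact ⟨_, act_mon e a b c d⟩
  choose! f hf using hdiff
  choose! g hg using hact'
  -- Two successive eigenvalue filters: first degree 0 under ad ∇, then eigenvalue 1 under ρ.
  have hP1 := mem_span_eigen (LinearMap.mulLeft ℂ eulerOp - LinearMap.mulRight ℂ eulerOp) monSet f
    (fun s hs => hf s hs) (weyl_le_span hP) (μ := 0) (by simpa using hdeg)
  have hP2 := mem_span_eigen (act (rho e)).toLinearMap _ g (fun s hs => hg s hs.1) hP1 (μ := 1)
    (by simpa using hact)
  refine (Submodule.span_le (p := Subalgebra.toSubmodule U)).2 ?_ hP2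
  rintro s ⟨⟨hs, hs0⟩, hs1⟩
  have hs0' := hf s hs
  have hs1' := hg s hs
  rw [hs0, zero_smul] at hs0'
  rw [hs1, one_smul] at hs1'
  obtain ⟨a, b, c, d, rfl⟩ := hs
  -- Eigenvalues can be compared only on a nonzero monomial.
  by_cases hz : mon a b c d = 0
  · rw [hz]; exact zero_mem U
  have hd := mem_degPart.1 (mon_mem_degPart a b c d)
  rw [hs0', eq_comm, smul_eq_zero_iff_left hz] at hd
  have hd' : a + b = c + d := by
    have : (a : ℤ) + b - c - d = 0 := by exact_mod_cast hd
    omega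
  have hw := act_mon e a b c d
  rw [hs1', eq_comm] at hw
  have hw' : wt e 0 ^ a * wt e 1 ^ b * (wt e 0)⁻¹ ^ c * (wt e 1)⁻¹ ^ d = 1 :=
    smul_left_injective ℂ hz (hw.trans (one_smul ℂ _).symm)
  have he0 := eps_ne_zero e
  simp only [wt, Matrix.cons_val_zero, Matrix.cons_val_one, inv_inv, inv_pow] at hw'
  have hw2 : eps e ^ (a + d) = eps e ^ (b + c) := by
    field_simp at hw'
    rw [pow_add, pow_add]; linear_combination hw'
  -- The surplus m = |a-c| turns the weight equation into ε^(2m) = 1, that is e ∣ 2m.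
  rcases le_total c a with h | h
  · obtain ⟨m, rfl⟩ := Nat.exists_eq_add_of_le' h
    obtain rfl : d = b + m := by omega
    rw [SetLike.mem_coe, Subalgebra.mem_toSubmodule, mon_eq_of_zero_one]
    refine monomial_mem_of_pow_mem (by decide) h0 h1 (hpow (by decide) h01 m ?_) b c
    rw [← (eps_isPrimitiveRoot he).pow_eq_one_iff_dvd]
    have : eps e ^ (b + c) * eps e ^ (2 * m) = eps e ^ (b + c) * 1 := by
      rw [← pow_add, mul_one, ← hw2]; congr 1; ring
    exact mul_left_cancel₀ (pow_ne_zero _ he0) this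
  · obtain ⟨m, rfl⟩ := Nat.exists_eq_add_of_le h
    obtain rfl : b = m + d := by omega
    rw [SetLike.mem_coe, Subalgebra.mem_toSubmodule, mon_eq_of_one_zero]
    refine monomial_mem_of_pow_mem (by decide) h1 h0 (hpow (by decide) h10 m ?_) a d
    rw [← (eps_isPrimitiveRoot he).pow_eq_one_iff_dvd]
    have : eps e ^ (a + d) * eps e ^ (2 * m) = eps e ^ (a + d) * 1 := by
      rw [← pow_add, mul_one, hw2]; congr 1; ring
    exact mul_left_cancel₀ (pow_ne_zero _ he0) this

/-! ### The degree zero algebra -/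

/-- The inclusion of `D₁` in the operators on `B`. -/
def D1.toEnd (e : ℕ) : D1 e →ₐ[ℂ] Module.End ℂ B := (invOps e).val

/-- The inclusion of `D₁⁰` in the operators on `B`. -/
def toEnd (e : ℕ) : D0 e →ₐ[ℂ] Module.End ℂ B := (D1.toEnd e).comp (D0 e).val

theorem toEnd_injective (e : ℕ) : Function.Injective (toEnd e) :=
  Subtype.val_injective.comp Subtype.val_injective

theorem toEnd_xdPow (e k : ℕ) (i j : Fin 2) (h : i = j ∨ e ∣ 2 * k) :
    toEnd e (xdPow e k i j h) = (xOp i * dOp j) ^ k := rfl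

theorem toEnd_nabla (e : ℕ) (i : Fin 2) : toEnd e (nabla e i) = xOp i * dOp i :=
  (toEnd_xdPow e 1 i i _).trans (pow_one _)

theorem toEnd_raise (e k : ℕ) (h : e ∣ 2 * k) : toEnd e (raise e k h) = (xOp 0 * dOp 1) ^ k := rfl

theorem toEnd_lower (e k : ℕ) (h : e ∣ 2 * k) : toEnd e (lower e k h) = (xOp 1 * dOp 0) ^ k := rfl

theorem toEnd_euler (e : ℕ) : D1.toEnd e (euler e) = eulerOp := rfl

theorem toEnd_degPart {e : ℕ} {P : D1 e} {n : ℤ} (h : P ∈ degPart (euler e) n) :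
    D1.toEnd e P ∈ degPart eulerOp n := by
  have := congrArg (D1.toEnd e) (mem_degPart.1 h)
  rwa [map_sub, map_mul, map_mul, map_smul, toEnd_euler] at this

theorem mem_adjoin_of_toEnd {e : ℕ} {S : Set (D0 e)} {p : D0 e}
    (h : toEnd e p ∈ Algebra.adjoin ℂ (toEnd e '' S)) : p ∈ Algebra.adjoin ℂ S := by
  rw [← AlgHom.map_adjoin] at h
  obtain ⟨q, hq, hqp⟩ := h
  rwa [← toEnd_injective e hqp]

theorem rho_mem_cyc (e : ℕ) : rho e ∈ cyc e := Subgroup.mem_zpowers _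

/-- The two divisibility hypotheses say that {m : e ∣ 2m} is the set of multiples of k, which treats
both parities at once. -/
theorem adjoin_eq_top {e k : ℕ} (he : 0 < e) (hk : ∀ m, e ∣ 2 * m → k ∣ m) (h : e ∣ 2 * k) :
    Algebra.adjoin ℂ ({nabla e 0, nabla e 1, raise e k h, lower e k h} : Set (D0 e)) = ⊤ := by
  refine eq_top_iff.2 fun p _ => mem_adjoin_of_toEnd ?_
  have hp : toEnd e p ∈ invOps e := p.1.2
  have hsub := Algebra.subset_adjoin (R := ℂ)
    (s := toEnd e '' {nabla e 0, nabla e 1, raise e k h, lower e k h})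
  refine mem_of_invariant he hk ?_ ?_ ?_ ?_ hp.1 ?_ (hp.2 _ (rho_mem_cyc e))
  · rw [← toEnd_nabla e 0]; exact hsub ⟨_, by simp, rfl⟩
  · rw [← toEnd_nabla e 1]; exact hsub ⟨_, by simp, rfl⟩
  · rw [← toEnd_raise e k h]; exact hsub ⟨_, by simp, rfl⟩
  · rw [← toEnd_lower e k h]; exact hsub ⟨_, by simp, rfl⟩
  · have := mem_degPart.1 (toEnd_degPart (mem_degZero.1 p.2))
    rwa [Int.cast_zero, zero_smul] at this

theorem mem_nablaAlg {e : ℕ} {p : D0 e}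
    (h : toEnd e p ∈ Algebra.adjoin ℂ {xOp 0 * dOp 0, xOp 1 * dOp 1}) : p ∈ nablaAlg e := by
  refine mem_adjoin_of_toEnd ?_
  rwa [Set.image_pair, toEnd_nabla, toEnd_nabla]

/-! ### Products of opposite powers and commutation with ∇ᵢ -/

theorem dOp_pow_mul_xOp_pow_mem {U : Subalgebra ℂ (Module.End ℂ B)} {i : Fin 2}
    (hi : xOp i * dOp i ∈ U) (k : ℕ) : dOp i ^ k * xOp i ^ k ∈ U := by
  induction k with
  | zero => simp
  | succ k ih =>
    -- ∂ᵏxᵏ is the rising factorial (∇+1)⋯(∇+k).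
    have h : dOp i ^ (k + 1) * xOp i ^ (k + 1)
        = dOp i ^ k * xOp i ^ k * (xOp i * dOp i + (k + 1) • 1) := by
      rw [pow_succ (dOp i), mul_assoc, dOp_mul_xOp_pow, Nat.add_sub_cancel, mul_assoc, mul_add,
        pow_succ]
      simp only [mul_add, mul_assoc, mul_smul_comm, mul_one]
    rw [h]
    exact mul_mem ih (add_mem hi (U.nsmul_mem (one_mem U) _))

theorem xOp_pow_mul_dOp_pow_mem {U : Subalgebra ℂ (Module.End ℂ B)} {i j : Fin 2} (hij : i ≠ j)
    (hi : xOp i * dOp i ∈ U) (hj : xOp j * dOp j ∈ U) (k : ℕ) : xOp i ^ k * dOp i ^ k ∈ U := by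
  simpa using monomial_mem_of_pow_mem hij hi hj (m := 0) (by simp) 0 k

/-- Regrouping by variable gives (xᵢᵏ∂ᵢᵏ)(∂ⱼᵏxⱼᵏ), a falling factorial in ∇ᵢ times a rising one in
∇ⱼ. -/
theorem xd_pow_mul_xd_pow_mem {U : Subalgebra ℂ (Module.End ℂ B)} {i j : Fin 2} (hij : i ≠ j)
    (hi : xOp i * dOp i ∈ U) (hj : xOp j * dOp j ∈ U) (k : ℕ) :
    (xOp i * dOp j) ^ k * (xOp j * dOp i) ^ k ∈ U := by
  have h1 : Commute (dOp i ^ k) (dOp j ^ k * xOp j ^ k) :=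
    ((dOp_commute i j).pow_pow k k).mul_right ((xOp_dOp_commute hij.symm).symm.pow_pow k k)
  have h : (xOp i * dOp j) ^ k * (xOp j * dOp i) ^ k
      = xOp i ^ k * dOp i ^ k * (dOp j ^ k * xOp j ^ k) := by
    rw [xd_pow hij, xd_pow hij.symm, mul_assoc (xOp i ^ k) (dOp i ^ k), h1.eq]
    simp only [mul_assoc]
  rw [h]
  exact mul_mem (xOp_pow_mul_dOp_pow_mem hij hi hj k) (dOp_pow_mul_xOp_pow_mem hj k)

theorem xdPow_mul_xdPow_mem {e k : ℕ} {i j : Fin 2} (hij : i ≠ j) (h : i = j ∨ e ∣ 2 * k)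
    (h' : j = i ∨ e ∣ 2 * k) : xdPow e k i j h * xdPow e k j i h' ∈ nablaAlg e := by
  apply mem_nablaAlg
  rw [map_mul, toEnd_xdPow, toEnd_xdPow]
  have H : ∀ l : Fin 2, xOp l * dOp l ∈ Algebra.adjoin ℂ {xOp 0 * dOp 0, xOp 1 * dOp 1} := by
    intro l
    apply Algebra.subset_adjoin
    fin_cases l <;> simp
  exact xd_pow_mul_xd_pow_mem hij (H i) (H j) k

/-- xᵢ and ∂ⱼ are homogeneous for ad ∇ₗ, hence so is (xᵢ∂ⱼ)ᵏ. This is what makes the tᵢ normalize ℰ.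
-/
theorem exists_nabla_mul_xdPow {e k : ℕ} {i j : Fin 2} (h : i = j ∨ e ∣ 2 * k) (l : Fin 2) :
    ∃ z : ℂ, nabla e l * xdPow e k i j h = xdPow e k i j h * nabla e l + z • xdPow e k i j h := by
  obtain ⟨m, hm⟩ : ∃ m, xOp i ∈ degPart (xOp l * dOp l) m := by
    rcases eq_or_ne l i with rfl | hl
    exacts [⟨_, xOp_mem_degPart l⟩, ⟨_, xOp_mem_degPart_of_ne hl⟩]
  obtain ⟨n, hn⟩ : ∃ n, dOp j ∈ degPart (xOp l * dOp l) n := by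
    rcases eq_or_ne l j with rfl | hl
    exacts [⟨_, dOp_mem_degPart l⟩, ⟨_, dOp_mem_degPart_of_ne hl⟩]
  have := mem_degPart.1 (pow_mem_degPart (mul_mem_degPart hm hn) k)
  refine ⟨((k * (m + n) : ℤ) : ℂ), toEnd_injective e ?_⟩
  rw [map_add, map_mul, map_mul, map_smul, toEnd_xdPow, toEnd_nabla]
  rw [sub_eq_iff_eq_add'] at this
  exact this

theorem nabla_zero_mul_raise (e k : ℕ) (h : e ∣ 2 * k) :
    nabla e 0 * raise e k h = raise e k h * nabla e 0 + (k : ℂ) • raise e k h := by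
  have := mem_degPart.1 (pow_mem_degPart (mul_mem_degPart (xOp_mem_degPart 0)
    (dOp_mem_degPart_of_ne (i := 0) (j := 1) (by decide))) k)
  apply toEnd_injective e
  rw [map_add, map_mul, map_mul, map_smul, toEnd_raise, toEnd_nabla]
  rw [sub_eq_iff_eq_add'] at this
  simpa using this

/-! ### The residue ring -/

/-- Membership in the left ideal is certified by a factorization checked on operators alone; the
factor Q need not be homogeneous. -/
theorem proj_eq_zero {e : ℕ} {p : D0 e} {Q N : D1 e} {n : ℤ} (hn : n < 0)
    (hN : D1.toEnd e N ∈ degPart eulerOp n) (hp : toEnd e p = D1.toEnd e Q * D1.toEnd e N) :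
    proj e p = 0 := by
  refine Ideal.Quotient.eq_zero_iff_mem.2 ?_
  have h : (p : D1 e) = Q * N := Subtype.val_injective hp
  have hN' : N ∈ negPart (euler e) := by
    refine (le_iSup₂ (f := fun (n : ℤ) (_ : n < 0) => degPart (euler e) n) n hn) ?_
    rw [mem_degPart] at hN ⊢
    apply Subtype.val_injective
    exact hN
  change (p : D1 e) ∈ Ideal.span _
  rw [h]
  exact Ideal.mul_mem_left _ _ (Ideal.subset_span hN')

theorem wt_pow (e : ℕ) (i : Fin 2) : wt e i ^ e = 1 := by
  fin_cases i <;> simp [wt, eps_pow]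

/-- Both xᵢᵉ and ∂ⱼᵉ are invariant separately, as their weights are e-th roots of unity, and ∂ⱼᵉ has
degree -e < 0. -/
theorem proj_eq_zero_of_pow {e : ℕ} (he : 0 < e) {p : D0 e} {i j : Fin 2}
    (hp : toEnd e p = xOp i ^ e * dOp j ^ e) : proj e p = 0 := by
  have hx : xOp i ^ e ∈ invOps e := ⟨pow_mem (xOp_mem i) e, act_of_rho (by
    rw [map_pow, act_xOp, smul_pow, wt_pow, one_smul])⟩
  have hd : dOp j ^ e ∈ invOps e := ⟨pow_mem (dOp_mem j) e, act_of_rho (by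
    rw [map_pow, act_dOp, smul_pow, inv_pow, wt_pow, inv_one, one_smul])⟩
  exact proj_eq_zero (Q := D1.mk _ hx) (N := D1.mk _ hd) (n := e * -1) (by omega)
    (pow_mem_degPart (dOp_mem_degPart_euler j) e) hp

/-! ### Evaluation on polynomials: t₁ is nonzero in R₁ -/

theorem coeff_eulerOp (f : B) (s : Fin 2 →₀ ℕ) :
    (eulerOp f).coeff s = ((s 0 : ℂ) + s 1) * f.coeff s := by
  induction f using MvPolynomial.induction_on' with
  | monomial u a =>
    simp only [eulerOp, LinearMap.add_apply, Module.End.mul_apply, xOp_apply, dOp_apply,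
      MvPolynomial.X_mul_pderiv_monomial, MvPolynomial.coeff_add, MvPolynomial.coeff_smul,
      MvPolynomial.coeff_monomial]
    split_ifs with h
    · subst h; simp; ring
    · simp
  | add p q hp hq => rw [map_add, MvPolynomial.coeff_add, hp, hq, MvPolynomial.coeff_add, mul_add]

theorem rho_monomial (e : ℕ) (u : Fin 2 →₀ ℕ) (a : ℂ) :
    rho e (MvPolynomial.monomial u a)
      = (wt e 0 ^ u 0 * wt e 1 ^ u 1) • MvPolynomial.monomial u a := by
  have hC : rho e (MvPolynomial.C a) = MvPolynomial.C a := (rho e).commutes a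
  rw [MvPolynomial.monomial_eq, Finsupp.prod_fintype _ _ (by simp), Fin.prod_univ_two]
  simp only [map_mul, map_pow, rho_X, hC, smul_pow, smul_mul_assoc, mul_smul_comm, smul_smul]
  rw [mul_comm (wt e 1 ^ u 1)]

theorem coeff_rho (e : ℕ) (f : B) (s : Fin 2 →₀ ℕ) :
    (rho e f).coeff s = wt e 0 ^ s 0 * wt e 1 ^ s 1 * f.coeff s := by
  induction f using MvPolynomial.induction_on' with
  | monomial u a =>
    rw [rho_monomial, MvPolynomial.coeff_smul, MvPolynomial.coeff_monomial]
    split_ifs with h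
    · subst h; simp
    · simp
  | add p q hp hq => rw [map_add, MvPolynomial.coeff_add, hp, hq, MvPolynomial.coeff_add, mul_add]

theorem X_pow_eq_monomial (k : ℕ) :
    (MvPolynomial.X 1 ^ k : B) = MvPolynomial.monomial (Finsupp.single 1 k) 1 :=
  MvPolynomial.X_pow_eq_monomial

/-- The polynomial `x₂ᵏ` is a lowest weight vector for the invariants of the cyclic group of
order `2k`. -/
theorem degPart_apply_eq_zero {k : ℕ} (hk : 0 < k) {P : D1 (2 * k)} {n : ℤ} (hn : n < 0)
    (hP : P ∈ degPart (euler (2 * k)) n) : D1.toEnd (2 * k) P (MvPolynomial.X 1 ^ k) = 0 := by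
  set f : B := MvPolynomial.X 1 ^ k with hf
  have hinv : D1.toEnd (2 * k) P ∈ invOps (2 * k) := P.2
  have hdeg := mem_degPart.1 (toEnd_degPart hP)
  set Q := D1.toEnd (2 * k) P
  have hEf : eulerOp f = (k : ℂ) • f := by
    ext s
    rw [coeff_eulerOp, MvPolynomial.coeff_smul, hf, X_pow_eq_monomial, MvPolynomial.coeff_monomial]
    split_ifs with h
    · subst h; simp
    · simp
  have hrf : rho (2 * k) f = wt (2 * k) 1 ^ k • f := by
    rw [hf, map_pow, rho_X, smul_pow]
  have hE : eulerOp (Q f) = ((k : ℂ) + n) • Q f := by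
    have := congrArg (fun T : Module.End ℂ B => T f) hdeg
    simp only [LinearMap.sub_apply, Module.End.mul_apply, LinearMap.smul_apply, hEf, map_smul,
      sub_eq_iff_eq_add] at this
    rw [this, ← add_smul, add_comm]
  have hr : rho (2 * k) (Q f) = wt (2 * k) 1 ^ k • Q f := by
    have := congrArg (fun T : Module.End ℂ B => T (rho (2 * k) f)) (hinv.2 _ (rho_mem_cyc _))
    simp only [act_apply, AlgEquiv.symm_apply_apply] at this
    rw [this, hrf, map_smul]
  ext s
  rw [MvPolynomial.coeff_zero]
  -- A surviving monomial x₁^s₀ x₂^s₁ would satisfy s₀ + s₁ = k + n and ε^s₁ = ε^(s₀+k).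
  by_contra hc
  have h1 := coeff_eulerOp (Q f) s
  have h2 := coeff_rho (2 * k) (Q f) s
  rw [hE, MvPolynomial.coeff_smul, smul_eq_mul] at h1
  rw [hr, MvPolynomial.coeff_smul, smul_eq_mul] at h2
  have h1' : (k : ℤ) + n = s 0 + s 1 := by exact_mod_cast mul_right_cancel₀ hc h1
  have h2' := mul_right_cancel₀ hc h2
  have he0 := eps_ne_zero (2 * k)
  simp only [wt, Matrix.cons_val_zero, Matrix.cons_val_one, inv_pow] at h2'
  have h3 : eps (2 * k) ^ s 1 = eps (2 * k) ^ (s 0 + k) := by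
    field_simp at h2'
    rw [pow_add, h2', mul_comm]
  -- Both exponents are below 2k because s₀ + s₁ < k; hence s₁ = s₀ + k, which contradicts that
  -- bound.
  have := (eps_isPrimitiveRoot (e := 2 * k) (by omega)).pow_inj (by omega) (by omega) h3
  omega

/-- Annihilating a fixed polynomial is a left ideal condition, so it passes from D₁⁻ to D₁·D₁⁻. -/
theorem apply_eq_zero_of_proj_eq_zero {k : ℕ} (hk : 0 < k) {p : D0 (2 * k)}
    (hp : proj (2 * k) p = 0) : toEnd (2 * k) p (MvPolynomial.X 1 ^ k) = 0 := by
  have h : (p : D1 (2 * k)) ∈ Ideal.span (negPart (euler (2 * k)) : Set (D1 (2 * k))) :=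
    show p ∈ lowestIdeal (euler (2 * k)) from Ideal.Quotient.eq_zero_iff_mem.1 hp
  change D1.toEnd (2 * k) (p : D1 (2 * k)) (MvPolynomial.X 1 ^ k) = 0
  -- The induction passes through elements of the left ideal that need not have degree zero.
  generalize (p : D1 (2 * k)) = P at h
  induction h using Submodule.span_induction with
  | mem x hx =>
    have hle : negPart (euler (2 * k)) ≤ LinearMap.ker
        ((LinearMap.applyₗ (R := ℂ) (MvPolynomial.X 1 ^ k : B)).comp
          (D1.toEnd (2 * k)).toLinearMap) :=
      iSup₂_le fun n hn y hy => degPart_apply_eq_zero hk hn hy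
    exact hle hx
  | zero => simp
  | add x y _ _ hx hy => rw [map_add, LinearMap.add_apply, hx, hy, add_zero]
  | smul r x _ hx => rw [smul_eq_mul, map_mul, Module.End.mul_apply, hx, map_zero]

theorem dOp_pow_apply (k : ℕ) :
    (dOp 1 ^ k) (MvPolynomial.X 1 ^ k : B) = MvPolynomial.C (k.factorial : ℂ) := by
  induction k with
  | zero => simp
  | succ k ih =>
    rw [pow_succ, Module.End.mul_apply, dOp_apply, Derivation.leibniz_pow]
    simp only [MvPolynomial.pderiv_X_self, Nat.add_sub_cancel, smul_eq_mul, mul_one, map_nsmul, ih]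
    rw [Nat.factorial_succ, nsmul_eq_mul, Nat.cast_mul, map_mul]
    simp

/-- The operator sends x₂ᵏ to k!·x₁ᵏ ≠ 0. -/
theorem proj_raise_ne_zero {k : ℕ} (hk : 0 < k) :
    proj (2 * k) (raise (2 * k) k dvd_rfl) ≠ 0 := by
  intro h
  have h' := apply_eq_zero_of_proj_eq_zero hk h
  have hx : ∀ (m : ℕ) (f : B), (xOp 0 ^ m) f = MvPolynomial.X 0 ^ m * f := by
    intro m f
    rw [xOp, LinearMap.pow_mulLeft]; rfl
  rw [toEnd_raise, xd_pow (by decide), Module.End.mul_apply, dOp_pow_apply, hx] at h'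
  simp [Nat.factorial_ne_zero] at h'

/-! ### Structure of R₁ over the image of Π -/

theorem proj_surjective (e : ℕ) : Function.Surjective (proj e) := Ideal.Quotient.mk_surjective

theorem mem_range_bigPi {e : ℕ} {p : D0 e} (hp : p ∈ nablaAlg e) : proj e p ∈ (bigPi e).range :=
  ⟨⟨p, hp⟩, rfl⟩

theorem nabla_mem (e : ℕ) (i : Fin 2) : nabla e i ∈ nablaAlg e :=
  Algebra.subset_adjoin (by fin_cases i <;> simp)

theorem nabla_commute (e : ℕ) : Commute (nabla e 0) (nabla e 1) := by
  apply toEnd_injective e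
  simp only [map_mul, toEnd_nabla]
  exact ((commute_of_mem_degPart (xOp_mem_degPart_of_ne (i := 0) (j := 1) (by decide))).mul_right
    (commute_of_mem_degPart (dOp_mem_degPart_of_ne (i := 0) (j := 1) (by decide)))).eq

theorem adjoin_proj_eq_top {e k : ℕ} (he : 0 < e) (hk : ∀ m, e ∣ 2 * m → k ∣ m) (h : e ∣ 2 * k) :
    Algebra.adjoin ℂ ({proj e (nabla e 0), proj e (nabla e 1), proj e (raise e k h),
      proj e (lower e k h)} : Set (R1 e)) = ⊤ := by
  have := congrArg (Subalgebra.map (proj e)) (adjoin_eq_top he hk h)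
  rw [AlgHom.map_adjoin, Algebra.map_top, (AlgHom.range_eq_top _).2 (proj_surjective e)] at this
  simpa only [Set.image_insert_eq, Set.image_singleton] using this

theorem range_bigPi (e : ℕ) :
    (bigPi e).range = Algebra.adjoin ℂ {proj e (nabla e 0), proj e (nabla e 1)} := by
  rw [bigPi, AlgHom.range_comp, Subalgebra.range_val, nablaAlg, AlgHom.map_adjoin, Set.image_pair]

theorem exists_proj_nabla_mul {e k : ℕ} {i j : Fin 2} (h : i = j ∨ e ∣ 2 * k) (l : Fin 2) :
    ∃ u ∈ (bigPi e).range,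
      proj e (nabla e l) * proj e (xdPow e k i j h) = proj e (xdPow e k i j h) * u := by
  obtain ⟨z, hz⟩ := exists_nabla_mul_xdPow h l
  refine ⟨_, mem_range_bigPi (add_mem (nabla_mem e l)
    (Subalgebra.smul_mem _ (one_mem (nablaAlg e)) z)), ?_⟩
  rw [← map_mul, ← map_mul, hz, mul_add, mul_smul_comm, mul_one]

theorem exists_mul_proj_nabla {e k : ℕ} {i j : Fin 2} (h : i = j ∨ e ∣ 2 * k) (l : Fin 2) :
    ∃ u ∈ (bigPi e).range,
      proj e (xdPow e k i j h) * proj e (nabla e l) = u * proj e (xdPow e k i j h) := by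
  obtain ⟨z, hz⟩ := exists_nabla_mul_xdPow h l
  refine ⟨_, mem_range_bigPi (sub_mem (nabla_mem e l)
    (Subalgebra.smul_mem _ (one_mem (nablaAlg e)) z)), ?_⟩
  rw [← map_mul, ← map_mul, sub_mul, hz, smul_mul_assoc, one_mul, add_sub_cancel_right]

/-- The square is xᵢ^(2k)∂ⱼ^(2k) = xᵢᵉ∂ⱼᵉ, which already vanishes. -/
theorem proj_xdPow_mul_self {e k : ℕ} (he : 0 < e) (hk : e = 2 * k) {i j : Fin 2} (hij : i ≠ j)
    (h : i = j ∨ e ∣ 2 * k) : proj e (xdPow e k i j h) * proj e (xdPow e k i j h) = 0 := by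
  rw [← map_mul]
  apply proj_eq_zero_of_pow he (i := i) (j := j)
  rw [map_mul, toEnd_xdPow, ← pow_add, ← two_mul, ← hk, xd_pow hij]

theorem proj_xdPow_mul_swap_mem {e k : ℕ} {i j : Fin 2} (hij : i ≠ j) (h : i = j ∨ e ∣ 2 * k)
    (h' : j = i ∨ e ∣ 2 * k) :
    proj e (xdPow e k i j h) * proj e (xdPow e k j i h') ∈ (bigPi e).range := by
  rw [← map_mul]
  exact mem_range_bigPi (xdPow_mul_xdPow_mem hij h h')

theorem range_bigPi_eq_top_of_odd {e : ℕ} (he : Odd e) : (bigPi e).range = ⊤ := by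
  have hd : ∀ m, e ∣ 2 * m → e ∣ m := fun m h =>
    (Nat.Coprime.dvd_of_dvd_mul_left (Nat.coprime_two_right.2 he) h)
  have h := adjoin_proj_eq_top he.pos hd (Dvd.intro_left 2 rfl)
  -- With k = e the two generators other than the ∇ᵢ have class zero.
  rw [proj_eq_zero_of_pow (p := raise e e _) (i := 0) (j := 1) he.pos
      (by rw [toEnd_raise, xd_pow (by decide)]),
    proj_eq_zero_of_pow (p := lower e e _) (i := 1) (j := 0) he.pos
      (by rw [toEnd_lower, xd_pow (by decide)])] at h
  rw [eq_top_iff, ← h, Algebra.adjoin_le_iff]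
  rintro x (rfl | rfl | rfl | rfl)
  exacts [mem_range_bigPi (nabla_mem e 0), mem_range_bigPi (nabla_mem e 1), zero_mem _, zero_mem _]

theorem commute_of_mem_range_bigPi {e : ℕ} {a b : R1 e} (ha : a ∈ (bigPi e).range)
    (hb : b ∈ (bigPi e).range) : a * b = b * a := by
  rw [range_bigPi] at ha hb
  have hc : proj e (nabla e 0) * proj e (nabla e 1) = proj e (nabla e 1) * proj e (nabla e 0) := by
    rw [← map_mul, (nabla_commute e).eq, map_mul]
  refine Algebra.commute_of_mem_adjoin_of_forall_mem_commute hb fun y hy => Commute.symm ?_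
  refine Algebra.commute_of_mem_adjoin_of_forall_mem_commute ha fun x hx => ?_
  rcases hx with rfl | rfl <;> rcases hy with rfl | rfl
  exacts [rfl, hc.symm, hc, rfl]

end CyclicWeyl

end

/-! ### The two parities -/

theorem proposition6p3 (e : ℕ) (he : 0 < e) :
    (Odd e →
      Algebra.adjoin ℂ
          ({CyclicWeyl.nabla e 0, CyclicWeyl.nabla e 1,
            CyclicWeyl.raise e e (Dvd.intro_left 2 rfl),
            CyclicWeyl.lower e e (Dvd.intro_left 2 rfl)} : Set (CyclicWeyl.D0 e)) = ⊤ ∧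
      Function.Surjective (CyclicWeyl.bigPi e) ∧
      ∀ a b : CyclicWeyl.R1 e, a * b = b * a) ∧
    (∀ (e₁ : ℕ) (h : e = 2 * e₁),
      Algebra.adjoin ℂ
          ({CyclicWeyl.nabla e 0, CyclicWeyl.nabla e 1,
            CyclicWeyl.raise e e₁ (dvd_of_eq h),
            CyclicWeyl.lower e e₁ (dvd_of_eq h)} : Set (CyclicWeyl.D0 e)) = ⊤ ∧
      (∀ r : CyclicWeyl.R1 e, ∃ a b c : (CyclicWeyl.bigPi e).range,
        r = (a : CyclicWeyl.R1 e)
          + b * CyclicWeyl.proj e (CyclicWeyl.raise e e₁ (dvd_of_eq h))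
          + c * CyclicWeyl.proj e (CyclicWeyl.lower e e₁ (dvd_of_eq h))) ∧
      (∀ r : CyclicWeyl.R1 e, ∃ a b c : (CyclicWeyl.bigPi e).range,
        r = (a : CyclicWeyl.R1 e)
          + CyclicWeyl.proj e (CyclicWeyl.raise e e₁ (dvd_of_eq h)) * b
          + CyclicWeyl.proj e (CyclicWeyl.lower e e₁ (dvd_of_eq h)) * c) ∧
      ∃ a b : CyclicWeyl.R1 e, a * b ≠ b * a) := by
  open CyclicWeyl in
  refine ⟨fun hodd => ⟨adjoin_eq_top he (fun m h =>
    Nat.Coprime.dvd_of_dvd_mul_left (Nat.coprime_two_right.2 hodd) h) _, ?_, ?_⟩, ?_⟩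
  · exact (AlgHom.range_eq_top _).1 (range_bigPi_eq_top_of_odd hodd)
  · intro a b
    exact commute_of_mem_range_bigPi (range_bigPi_eq_top_of_odd hodd ▸ Algebra.mem_top)
      (range_bigPi_eq_top_of_odd hodd ▸ Algebra.mem_top)
  · intro k h
    have hd : ∀ m, e ∣ 2 * m → k ∣ m := fun m hm => by
      rw [h] at hm
      exact Nat.dvd_of_mul_dvd_mul_left two_pos hm
    have hk : 0 < k := by omega
    have h01 : (0 : Fin 2) = 1 ∨ e ∣ 2 * k := Or.inr (dvd_of_eq h)
    have h10 : (1 : Fin 2) = 0 ∨ e ∣ 2 * k := Or.inr (dvd_of_eq h)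
    refine ⟨adjoin_eq_top he hd _, ?_, ?_, ?_⟩
    · exact exists_left_combination (adjoin_proj_eq_top he hd (dvd_of_eq h))
        (mem_range_bigPi (nabla_mem e 0)) (mem_range_bigPi (nabla_mem e 1))
        (exists_mul_proj_nabla h01 0) (exists_mul_proj_nabla h01 1)
        (exists_mul_proj_nabla h10 0) (exists_mul_proj_nabla h10 1)
        (proj_xdPow_mul_self he h (by decide) h01) (proj_xdPow_mul_self he h (by decide) h10)
        (proj_xdPow_mul_swap_mem (by decide) h01 h10) (proj_xdPow_mul_swap_mem (by decide) h10 h01)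
    · exact exists_right_combination (adjoin_proj_eq_top he hd (dvd_of_eq h))
        (mem_range_bigPi (nabla_mem e 0)) (mem_range_bigPi (nabla_mem e 1))
        (exists_proj_nabla_mul h01 0) (exists_proj_nabla_mul h01 1)
        (exists_proj_nabla_mul h10 0) (exists_proj_nabla_mul h10 1)
        (proj_xdPow_mul_self he h (by decide) h01) (proj_xdPow_mul_self he h (by decide) h10)
        (proj_xdPow_mul_swap_mem (by decide) h01 h10) (proj_xdPow_mul_swap_mem (by decide) h10 h01)
    · subst h
      -- The classes of ∇₁ and t₁ fail to commute: their commutator is k·t₁, and k ≠ 0 in ℂ.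
      refine ⟨proj _ (nabla _ 0), proj _ (raise (2 * k) k dvd_rfl), fun hc => ?_⟩
      rw [← map_mul, nabla_zero_mul_raise, map_add, map_mul, add_eq_left, map_smul] at hc
      apply proj_raise_ne_zero hk
      rw [← inv_smul_smul₀ (Nat.cast_ne_zero.2 hk.ne' : (k : ℂ) ≠ 0)
        (proj (2 * k) (raise (2 * k) k dvd_rfl)), hc, smul_zero]
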